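/- Assume Brouwer's (full) fan theorem: every bar is uniform. (A set $B$ of finite binary sequences is a bar if each infinite binary sequence has an initial segment in $B$; it is uniform if the lengths of these initial segments can be bounded independently of the infinite sequence.) A preference relation on a set is an asymmetric, negatively transitive binary relation $\succ$ (the latter: if $x\succ y$, then for every $z$ either $x\succ z$ or $z\succ y$). A preference relation $\succ$ on $X\subset\mathbf R^N$ is continuous if its graph $\{(x,x'):x\succ x'\}$ is open in $X\times X$, and strictly convex if $X$ is convex and for all $x\ne x'$ in $X$ and $t\in(0,1)$ one has $tx+(1-t)x'\succ x$ or $tx+(1-t)x'\succ x'$. Consider an economy with $N$ commodities, $n$ producers with production sets $Y_1,\dots,Y_n\subset\mathbf R^N$ and $m$ consumers with consumption sets $X_1,\dots,X_m\subset\mathbf R^N$, each $X_i$ carrying a preference relation $\succ_i$; consumers have no initial endowment. Let $Y=Y_1+\cdots+Y_n$ be the aggregate production set. For a price vector $p\in\mathbf R^N$ let the demand set $D_i(p)$ be the set of those $\xi$ in the budget set $\{x\in X_i:p\cdot x\le 0\}$ such that no $x$ in this budget set satisfies $x\succ_i\xi$; when $\succ_i$ is strictly convex, $D_i(p)$ has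 at most one element, which is denoted $F_i(p)$ when it exists. Suppose that (i) each $X_i$ is compact and convex; (ii) each $\succ_i$ is continuous and strictly convex; (iii) the interior of $X_i\cap Y$ is inhabited for each $i$; (iv) $Y$ is a located closed convex cone (located: inhabited, and the distance from each point of $\mathbf R^N$ to $Y$ exists as an infimum); (v) $Y\cap\{(x_1,\dots,x_N):x_j\ge 0\text{ for each }j\}=\{0\}$; (vi) for each $p\in\mathbf R^N$ for which $F_1(p),\dots,F_m(p)$ are all defined, if $\sum_{j=1}^m F_j(p)\in Y$, then for each $i$ there exists $x_i\in X_i$ with $x_i\succ_i F_i(p)$. Then the economy has approximate competitive equilibria: for every $\varepsilon>0$ there exist a price vector $p\in\mathbf R^N$, points $\xi_1,\dots,\xi_m\in\mathbf R^N$ and a vector $\eta\in Y$ such that $\xi_i\in D_i(p)$ for each $1\le i\le m$, $\sum_{i=1}^m\xi_i=\eta$, and $p\cdot\eta>-\varepsilon$. -/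

import Mathlib

/-- Commodity space `ℝ^N` with its Euclidean structure; `p · x` is `inner ℝ p x`. -/
abbrev Commodity (N : ℕ) : Type := EuclideanSpace ℝ (Fin N)

/-! ### Brouwer's fan theorem -/

/-- The finite binary sequence formed by the first `k` terms of `α`. -/
def initialSegment (α : ℕ → Bool) (k : ℕ) : List Bool := (List.range k).map α

/-- A set of finite binary sequences is a bar if every infinite binary sequence has an initial
segment in it. -/
def IsBar (B : Set (List Bool)) : Prop :=
  ∀ α : ℕ → Bool, ∃ k : ℕ, initialSegment α k ∈ B

/-- A bar is uniform if the lengths of the initial segments can be bounded uniformly. -/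
def IsUniformBar (B : Set (List Bool)) : Prop :=
  ∃ K : ℕ, ∀ α : ℕ → Bool, ∃ k : ℕ, k ≤ K ∧ initialSegment α k ∈ B

/-- Brouwer's (full) fan theorem: every bar is uniform. -/
def FanTheorem : Prop := ∀ B : Set (List Bool), IsBar B → IsUniformBar B

/-! ### Preference relations -/

/-- A preference relation: asymmetric and negatively transitive. -/
structure IsPreference {X : Type} (r : X → X → Prop) : Prop where
  asymm : ∀ x y, r x y → ¬ r y x
  negTrans : ∀ x y, r x y → ∀ z, r x z ∨ r z y

/-- A preference relation on `X ⊆ ℝ^N` is continuous if its graph is open (in `X × X`). -/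
def IsContinuousPref {N : ℕ} {X : Set (Commodity N)} (r : X → X → Prop) : Prop :=
  IsOpen {q : X × X | r q.1 q.2}

/-- A preference relation on `X ⊆ ℝ^N` is strictly convex if `X` is convex and every
point `t x + (1 - t) x'` with `x ≠ x'` in `X` and `0 < t < 1` is preferred to `x` or to `x'`. -/
def IsStrictlyConvexPref {N : ℕ} {X : Set (Commodity N)} (r : X → X → Prop) : Prop :=
  Convex ℝ X ∧
    ∀ x x' : X, x ≠ x' → ∀ t : ℝ, 0 < t → t < 1 →
      ∀ z : X, (z : Commodity N) = t • (x : Commodity N) + (1 - t) • (x' : Commodity N) →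
        r z x ∨ r z x'

/-- The budget set `β(p, w) = {x ∈ X : p · x ≤ w}`. -/
def budgetSet {N : ℕ} (X : Set (Commodity N)) (p : Commodity N) (w : ℝ) : Set X :=
  {x | inner ℝ p (x : Commodity N) ≤ w}

/-- The demand set: the maximal elements `ξ` of the budget set, i.e. `ξ ≽ x` for all `x` in it,
where `ξ ≽ x` stands for `¬ (x ≻ ξ)`. -/
def demandSet {N : ℕ} {X : Set (Commodity N)} (r : X → X → Prop) (p : Commodity N) (w : ℝ) :
    Set X :=
  {ξ | ξ ∈ budgetSet X p w ∧ ∀ x ∈ budgetSet X p w, ¬ r x ξ}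

/-! ### Economies -/

/-- An economy with `N` commodities, `n` producers and `m` consumers. -/
structure Economy (N n m : ℕ) where
  /-- the production sets -/
  production : Fin n → Set (Commodity N)
  /-- the consumption sets -/
  consumption : Fin m → Set (Commodity N)
  /-- `pref i x y` means that consumer `i` prefers `x` to `y` -/
  pref : ∀ i : Fin m, consumption i → consumption i → Prop
  isPreference : ∀ i : Fin m, IsPreference (pref i)

/-- The aggregate production set `Y = Y₁ + ⋯ + Yₙ`. -/
def Economy.aggregate {N n m : ℕ} (E : Economy N n m) : Set (Commodity N) :=
  {y | ∃ z : Fin n → Commodity N, (∀ k, z k ∈ E.production k) ∧ ∑ k, z k = y}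

/-- The demand set `D_i(p)` of consumer `i`, who has no initial endowment (`w = 0`). When `≻_i` is
strictly convex it has at most one element, the value `F_i(p)` of the demand function. -/
def Economy.demand {N n m : ℕ} (E : Economy N n m) (i : Fin m) (p : Commodity N) :
    Set (E.consumption i) :=
  demandSet (E.pref i) p 0

/-- An inhabited set is located if the distance to it, as an infimum, exists at every point. -/
def IsLocated {N : ℕ} (S : Set (Commodity N)) : Prop :=
  S.Nonempty ∧ ∀ x : Commodity N, ∃ d : ℝ, IsGLB ((fun s => dist x s) '' S) d

/-- A cone: a set closed under multiplication by positive scalars. -/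
def IsConeSet {N : ℕ} (S : Set (Commodity N)) : Prop :=
  ∀ t : ℝ, 0 < t → ∀ y ∈ S, t • y ∈ S

/-- Approximate competitive equilibria: for every `ε > 0` there are prices `p`, demands
`ξ_i ∈ D_i(p)` and a vector `η` in the aggregate production set with `∑ ξ_i = η` and
`p · η > -ε`. -/
def Economy.HasApproxEquilibria {N n m : ℕ} (E : Economy N n m) : Prop :=
  ∀ ε : ℝ, 0 < ε →
    ∃ (p : Commodity N) (ξ : ∀ i : Fin m, E.consumption i) (η : Commodity N),
      η ∈ E.aggregate ∧
      (∀ i, ξ i ∈ E.demand i p) ∧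
      ∑ i, (ξ i : Commodity N) = η ∧
      -ε < inner ℝ p η

/-! An exact equilibrium is found, so that `p · η = 0`. Prices are sought in the polar cone of `Y`,
where no production is profitable. Slicing this cone by `p · v = -1`, with `v` interior to `Y`,
gives a compact convex set `P` that meets every ray of nonzero polar prices. At such prices each
consumer owns a point of negative cost (an interior point of `X_i ∩ Y`), which makes the graph of
demand closed; strict convexity makes demand single-valued, hence continuous on `P` by compactness
of `X_i`.

Let `Z p` be aggregate demand. The variational inequality `exists_forall_inner_le` gives `p ∈ P`
with `q · Z p ≤ p · Z p ≤ 0` for all `q ∈ P`. If `Z p` were outside `Y`, a polar vector separating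
it from `Y`, rescaled into `P`, would violate this. Hence `Z p ∈ Y`; nonsatiation then applies, and
Walras' law makes every budget constraint an equality.

The variational inequality reduces, by the finite intersection property, to a statement on a
simplex, the limit of a statement on finite grids. The grid statement rests on a combinatorial lemma
of Scarf's type, proved by a parity count. -/

section

open Finset Function Filter Topology

/-! ### Dominant sets and Scarf's lemma -/

/-- A finite set `S` is dominant for the utilities `u i` if no element is strictly better than the
worst element of `S` in every utility. -/
def IsDominant {I V L : Type*} [LinearOrder L] (u : I → V → L) (S : Finset V) : Prop :=
  ∀ y, ∃ i, ∀ s ∈ S, u i y ≤ u i s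

theorem IsDominant.mono {I V L : Type*} [LinearOrder L] {u : I → V → L} {S T : Finset V}
    (hS : IsDominant u S) (h : T ⊆ S) : IsDominant u T := fun y =>
  (hS y).imp fun _ hi s hs => hi s (h hs)

/-- A dominant set with one element fewer than there are utilities has exactly two dominant
extensions by one element. -/
theorem IsDominant.card_completions {I V L : Type*} [Fintype I] [Fintype V] [DecidableEq I]
    [DecidableEq V] [LinearOrder L] {u : I → V → L} [DecidablePred (IsDominant u)]
    (hu : ∀ i, Injective (u i)) {T : Finset V}
    (hT : IsDominant u T) (hne : T.Nonempty) (hcard : #T + 1 = Fintype.card I)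
    (hM : ∀ a j, a ≠ j → ∀ t ∈ T, (∀ s ∈ T, u a t ≤ u a s) → (∀ s ∈ T, u j t ≤ u j s) →
      ∃ y, ∀ b ≠ a, ∃ s ∈ T, u b s < u b y) :
    #{x | x ∉ T ∧ IsDominant u (insert x T)} = 2 := by
  have hf : ∀ i, ∃ t ∈ T, ∀ s ∈ T, u i t ≤ u i s := fun i => T.exists_min_image (u i) hne
  choose f hfT hfmin using hf
  have hsurj : ∀ t ∈ T, ∃ i, f i = t := fun t ht => by
    obtain ⟨i, hi⟩ := hT t
    exact ⟨i, hu i (le_antisymm (hfmin i t ht) (hi _ (hfT i)))⟩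
  -- `f` maps the utilities onto `T`, which has one element fewer, so `i, j` is the only pair it
  -- identifies. In a completion the new element takes over the minimum of `u i` or of `u j`, which
  -- gives the two cases.
  obtain ⟨i, -, j, -, hij, hfij⟩ : ∃ i ∈ (univ : Finset I), ∃ j ∈ (univ : Finset I), i ≠ j ∧
      f i = f j := by
    apply Finset.exists_ne_map_eq_of_card_lt_of_maps_to (t := T)
    · rw [Finset.card_univ]; omega
    · intro a _; exact hfT a
  have hsurj' : ∀ a, (a = i ∨ a = j) → ∀ t ∈ T, ∃ b, b ≠ a ∧ f b = t := by
    intro a ha t ht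
    obtain ⟨b, rfl⟩ := hsurj t ht
    by_cases hb : b = a
    · subst hb
      rcases ha with rfl | rfl
      · exact ⟨j, hij.symm, hfij.symm⟩
      · exact ⟨i, hij, hfij⟩
    · exact ⟨b, hb, rfl⟩
  -- The completion in which the new element is worst for `u a` is forced: it is the `u a`-best
  -- among the elements that beat all the other minima. `hM` provides such elements.
  have hmax : ∀ a, (a = i ∨ a = j) → ∃ x, (∀ b ≠ a, u b (f b) < u b x) ∧
      ∀ y, (∀ b ≠ a, u b (f b) < u b y) → u a y ≤ u a x := by
    intro a ha
    obtain ⟨y, hy⟩ : ∃ y, ∀ b ≠ a, ∃ s ∈ T, u b s < u b y := by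
      rcases ha with rfl | rfl
      · exact hM a j hij (f a) (hfT a) (hfmin a) (hfij ▸ hfmin j)
      · exact hM a i hij.symm (f a) (hfT a) (hfmin a) (hfij ▸ hfmin i)
    classical
    obtain ⟨x, hx, hxm⟩ := Finset.exists_max_image
      (univ.filter fun y => ∀ b ≠ a, u b (f b) < u b y) (u a) ⟨y, by
        simp only [mem_filter, mem_univ, true_and]
        intro b hb
        obtain ⟨s, hs, hlt⟩ := hy b hb
        exact (hfmin b s hs).trans_lt hlt⟩
    simp only [mem_filter, mem_univ, true_and] at hx hxm
    exact ⟨x, hx, hxm⟩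
  have hgood : ∀ a, (a = i ∨ a = j) → ∀ x, (∀ b ≠ a, u b (f b) < u b x) →
      (∀ y, (∀ b ≠ a, u b (f b) < u b y) → u a y ≤ u a x) →
      x ∉ T ∧ IsDominant u (insert x T) := by
    intro a ha x hx hxm
    have hxT : x ∉ T := fun h => by
      obtain ⟨b, hb, rfl⟩ := hsurj' a ha x h
      exact lt_irrefl _ (hx b hb)
    have hxa : ∀ s ∈ T, u a x ≤ u a s := by
      obtain ⟨c, hc⟩ := hT x
      by_cases hca : c = a
      · subst hca; exact hc
      · exact absurd (hx c hca) (not_lt.2 (hc _ (hfT c)))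
    refine ⟨hxT, fun y => ?_⟩
    by_cases hy : ∀ b ≠ a, u b (f b) < u b y
    · refine ⟨a, fun s hs => ?_⟩
      rcases Finset.mem_insert.1 hs with rfl | hs
      · exact hxm y hy
      · exact (hxm y hy).trans (hxa s hs)
    · push Not at hy
      obtain ⟨b, hb, hle⟩ := hy
      refine ⟨b, fun s hs => ?_⟩
      rcases Finset.mem_insert.1 hs with rfl | hs
      · exact hle.trans (hx b hb).le
      · exact hle.trans (hfmin b s hs)
  obtain ⟨xi, hxi, hxim⟩ := hmax i (Or.inl rfl)
  obtain ⟨xj, hxj, hxjm⟩ := hmax j (Or.inr rfl)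
  have hne' : xi ≠ xj := by
    rintro rfl
    obtain ⟨c, hc⟩ := hT xi
    by_cases hci : c = i
    · exact absurd (hxj c (hci ▸ hij)) (not_lt.2 (hc _ (hfT c)))
    · exact absurd (hxi c hci) (not_lt.2 (hc _ (hfT c)))
  rw [Finset.card_eq_two]
  refine ⟨xi, xj, hne', ?_⟩
  ext x
  simp only [mem_filter, mem_univ, true_and, mem_insert, mem_singleton]
  constructor
  · rintro ⟨hxT, hdom⟩
    have hg : ∀ s : (insert x T : Finset V), ∃ c, ∀ r ∈ insert x T, u c s ≤ u c r :=
      fun s => hdom s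
    choose g hgm using hg
    have hginj : Injective g := by
      intro s s' h
      apply Subtype.ext
      refine hu (g s) (le_antisymm (hgm s _ s'.2) ?_)
      rw [h]; exact hgm s' _ s.2
    have hgb : Bijective g := by
      rw [Fintype.bijective_iff_injective_and_card]
      exact ⟨hginj, by rw [Fintype.card_coe, card_insert_of_notMem hxT, hcard]⟩
    have hpre : ∀ b, b ≠ g ⟨x, mem_insert_self x T⟩ → f b ≠ x ∧ ∀ r ∈ insert x T,
        u b (f b) ≤ u b r := by
      intro b hb
      obtain ⟨s, rfl⟩ := hgb.2 b
      have hsT : (s : V) ∈ T := by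
        rcases Finset.mem_insert.1 s.2 with h | h
        · exact absurd (congrArg g (Subtype.ext h)) hb
        · exact h
      have : f (g s) = s := hu (g s) (le_antisymm (hfmin _ _ hsT)
        (hgm s _ (mem_insert_of_mem (hfT _))))
      rw [this]
      exact ⟨fun h => hxT (h ▸ hsT), hgm s⟩
    set a := g ⟨x, mem_insert_self x T⟩ with ha
    have hxa : ∀ r ∈ insert x T, u a x ≤ u a r := hgm ⟨x, mem_insert_self x T⟩
    -- Otherwise `i` and `j` would both be matched by `g` with the same element `f i = f j` of `T`.
    have haij : a = i ∨ a = j := by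
      by_contra hcon
      push Not at hcon
      obtain ⟨s, hs⟩ := hgb.2 i
      obtain ⟨s', hs'⟩ := hgb.2 j
      have key : ∀ b, b ≠ a → ∀ s, g s = b → (s : V) = f b := by
        rintro b hb s rfl
        exact hu (g s) (le_antisymm (hgm s _ (mem_insert_of_mem (hfT _))) ((hpre _ hb).2 _ s.2))
      have h1 := key i hcon.1.symm s hs
      have h2 := key j hcon.2.symm s' hs'
      apply hij
      rw [← hs, ← hs']
      exact congrArg g (Subtype.ext (by rw [h1, h2, hfij]))
    have hxM : ∀ b ≠ a, u b (f b) < u b x := fun b hb =>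
      lt_of_le_of_ne ((hpre b hb).2 x (mem_insert_self x T)) fun h => (hpre b hb).1 (hu b h)
    have hxmax : ∀ y, (∀ b ≠ a, u b (f b) < u b y) → u a y ≤ u a x := by
      intro y hy
      obtain ⟨c, hc⟩ := hdom y
      by_cases hca : c = a
      · subst hca; exact hc x (mem_insert_self x T)
      · exact absurd (hy c hca) (not_lt.2 (hc _ (mem_insert_of_mem (hfT c))))
    clear_value a
    rcases haij with rfl | rfl
    · exact Or.inl (hu a (le_antisymm (hxim x hxM) (hxmax xi hxi)))
    · exact Or.inr (hu a (le_antisymm (hxjm x hxM) (hxmax xj hxj)))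
  · rintro (rfl | rfl)
    · exact hgood i (Or.inl rfl) x hxi hxim
    · exact hgood j (Or.inr rfl) x hxj hxjm

/-- If a set with as many elements as there are labels does not carry all labels, then an even
number of its elements can be removed so as to leave exactly the labels other than `i₀`. -/
theorem even_card_erase_image_eq {I V : Type*} [Fintype I] [DecidableEq I] [DecidableEq V]
    (c : V → I) (i₀ : I) {S : Finset V} (hS : #S = Fintype.card I) (hc : S.image c ≠ univ) :
    Even #{x ∈ S | (S.erase x).image c = univ.erase i₀} := by
  by_cases h : ∃ x ∈ S, (S.erase x).image c = univ.erase i₀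
  · obtain ⟨x, hx, hxc⟩ := h
    have hcardx : #(S.erase x) = Fintype.card I - 1 := by rw [card_erase_of_mem hx, hS]
    have hinj : Set.InjOn c (S.erase x) := by
      rw [← Finset.card_image_iff, hxc, card_erase_of_mem (mem_univ _), hcardx, Finset.card_univ]
    have hSx : S.image c = insert (c x) (univ.erase i₀) := by
      rw [← hxc, ← Finset.image_insert, insert_erase hx]
    -- With label `i₀` on `x`, the set `S` would carry all labels. So `x` repeats the label of
    -- exactly one other element `x'`, and the removable elements are `x` and `x'`.
    have hcx : c x ≠ i₀ := by
      intro h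
      rw [h, insert_erase (mem_univ _)] at hSx
      exact hc hSx
    obtain ⟨x', hx', hcx'⟩ : ∃ x' ∈ S.erase x, c x' = c x := by
      rw [← Finset.mem_image, hxc]; simp [hcx]
    have hxx' : x' ≠ x := (mem_erase.1 hx').1
    have hx'S : x' ∈ S := (mem_erase.1 hx').2
    have hSi : S.image c = univ.erase i₀ := by
      rw [hSx, insert_eq_of_mem]; simp [hcx]
    suffices hset : {y ∈ S | (S.erase y).image c = univ.erase i₀} = {x, x'} by
      rw [hset, card_pair hxx'.symm]; exact even_two
    ext y
    simp only [mem_filter, mem_insert, mem_singleton]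
    constructor
    · rintro ⟨hy, hyc⟩
      by_contra hcon
      push Not at hcon
      have : c y ∈ (S.erase y).image c := by
        rw [hyc, ← hSi]; exact mem_image_of_mem c hy
      obtain ⟨z, hz, hzy⟩ := mem_image.1 this
      have hyx : y ∈ S.erase x := mem_erase.2 ⟨hcon.1, hy⟩
      by_cases hzx : z = x
      · subst hzx
        exact hcon.2 (hinj hyx hx' (hzy.symm.trans hcx'.symm))
      · exact (mem_erase.1 hz).1 (hinj (mem_erase.2 ⟨hzx, (mem_erase.1 hz).2⟩) hyx hzy)
    · rintro (rfl | rfl)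
      · exact ⟨hx, hxc⟩
      · refine ⟨hx'S, ?_⟩
        rw [← hSi]
        apply Subset.antisymm (image_subset_image (erase_subset _ _))
        intro k hk
        obtain ⟨z, hz, rfl⟩ := mem_image.1 hk
        by_cases hzy : z = y
        · subst hzy
          exact mem_image.2 ⟨x, mem_erase.2 ⟨hxx'.symm, hx⟩, hcx'.symm⟩
        · exact mem_image_of_mem c (mem_erase.2 ⟨hzy, hz⟩)
  · rw [Finset.filter_eq_empty_iff.2 (fun x hx hxc => h ⟨x, hx, hxc⟩)]
    simp

/-- A combinatorial lemma of Scarf's type: among the points `X` with one slack element for every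
utility, there is a dominant set carrying all labels. -/
theorem exists_isDominant_image_eq_univ {I X L : Type*} [Fintype I] [Fintype X] [Nonempty X]
    [DecidableEq I] [DecidableEq X] [LinearOrder L] {u : I → I ⊕ X → L}
    (hu : ∀ i, Injective (u i)) (hlow : ∀ i x, u i (.inl i) < u i (.inr x))
    (hhigh : ∀ i j x, i ≠ j → u i (.inr x) < u i (.inl j)) (c : X → I) :
    ∃ S, IsDominant u S ∧ S.image (Sum.elim id c) = univ := by
  classical
  by_contra hcon
  push Not at hcon
  obtain ⟨x₀⟩ := ‹Nonempty X›
  set i₀ := c x₀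
  set lab : I ⊕ X → I := Sum.elim id c with hlab
  set k := Fintype.card I with hk
  -- Rooms `R` and doors `D`: each room has an even number of doors, while each door lies in an even
  -- number of rooms, apart from a single one that lies in one room.
  let R : Finset (Finset (I ⊕ X)) := {S | #S = k ∧ IsDominant u S}
  let D : Finset (Finset (I ⊕ X)) := {T | #T + 1 = k ∧ T.image lab = univ.erase i₀}
  have hdouble := sum_card_bipartiteAbove_eq_sum_card_bipartiteBelow (s := D) (t := R)
    (fun T S => T ⊆ S)
  have hkpos : 0 < k := Fintype.card_pos_iff.2 ⟨i₀⟩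
  have hright : Even (∑ S ∈ R, #(D.bipartiteBelow (fun T S => T ⊆ S) S)) := by
    refine Finset.even_sum _ fun S hS => ?_
    obtain ⟨hSk, hSd⟩ : #S = k ∧ IsDominant u S := by simpa [R] using hS
    have := even_card_erase_image_eq lab i₀ hSk (hcon S hSd)
    have heq : D.bipartiteBelow (fun T S => T ⊆ S) S =
        {x ∈ S | (S.erase x).image lab = univ.erase i₀}.image S.erase := by
      ext T
      simp only [bipartiteBelow, D, mem_filter, mem_univ, true_and, mem_image]
      constructor
      · rintro ⟨⟨hTk, hTl⟩, hTS⟩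
        obtain ⟨x, hx⟩ : ∃ x, S \ T = {x} := by
          rw [← card_eq_one, card_sdiff_of_subset hTS]; omega
        have hxS : x ∈ S \ T := by rw [hx]; simp
        have hT : S.erase x = T := by
          rw [erase_eq, ← hx, Finset.sdiff_sdiff_eq_self hTS]
        exact ⟨x, ⟨(mem_sdiff.1 hxS).1, hT ▸ hTl⟩, hT⟩
      · rintro ⟨x, ⟨hxS, hxl⟩, rfl⟩
        exact ⟨⟨by rw [card_erase_of_mem hxS]; omega, hxl⟩, erase_subset _ _⟩
    rw [heq, card_image_of_injOn]
    · exact this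
    · intro x hx y hy hxy
      simp only [coe_filter, Set.mem_ofPred_eq] at hx hy
      exact (erase_injOn S) hx.1 hy.1 hxy
  have hcount : ∀ T ∈ D, #(R.bipartiteAbove (fun T S => T ⊆ S) T) =
      #{x | x ∉ T ∧ IsDominant u (insert x T)} := by
    intro T hT
    obtain ⟨hTk, -⟩ : #T + 1 = k ∧ T.image lab = univ.erase i₀ := by simpa [D] using hT
    have heq : R.bipartiteAbove (fun T S => T ⊆ S) T =
        ({x | x ∉ T ∧ IsDominant u (insert x T)} : Finset (I ⊕ X)).image (fun x => insert x T) := by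
      ext S
      simp only [bipartiteAbove, R, mem_filter, mem_univ, true_and, mem_image]
      constructor
      · rintro ⟨⟨hSk, hSd⟩, hTS⟩
        obtain ⟨x, hx⟩ : ∃ x, S \ T = {x} := by
          rw [← card_eq_one, card_sdiff_of_subset hTS]; omega
        have hxS : x ∈ S \ T := by rw [hx]; simp
        have hS : insert x T = S := by
          rw [insert_eq, ← hx, sdiff_union_of_subset hTS]
        exact ⟨x, ⟨(mem_sdiff.1 hxS).2, hS ▸ hSd⟩, hS⟩
      · rintro ⟨x, ⟨hxT, hxd⟩, rfl⟩
        exact ⟨⟨by rw [card_insert_of_notMem hxT]; omega, hxd⟩, subset_insert _ _⟩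
    rw [heq, card_image_of_injOn]
    intro x hx y hy hxy
    simp only [coe_filter, mem_univ, true_and, Set.mem_ofPred_eq] at hx hy
    exact (insert_inj hx.1).1 hxy
  -- The exceptional door. Its only completion adds the `u i₀`-best point.
  let T₀ : Finset (I ⊕ X) := (univ.erase i₀).image Sum.inl
  have hT₀D : T₀ ∈ D := by
    simp only [D, T₀, mem_filter, mem_univ, true_and]
    constructor
    · rw [card_image_of_injective _ Sum.inl_injective, card_erase_of_mem (mem_univ _),
        Finset.card_univ]
      omega
    · rw [image_image]; simp [hlab, comp_def]
  have hT₀ : #{x | x ∉ T₀ ∧ IsDominant u (insert x T₀)} = 1 := by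
    obtain ⟨m, -, hm⟩ := Finset.exists_max_image (univ : Finset X) (fun x => u i₀ (.inr x))
      ⟨x₀, mem_univ _⟩
    rw [card_eq_one]
    refine ⟨.inr m, ?_⟩
    ext v
    simp only [mem_filter, mem_univ, true_and, mem_singleton]
    have hmem : ∀ j, j ≠ i₀ → (Sum.inl j : I ⊕ X) ∈ T₀ := fun j hj => by simp [T₀, hj]
    constructor
    · rintro ⟨hvT, hd⟩
      obtain ⟨i, hi⟩ := hd (.inr m)
      obtain rfl : i = i₀ := by
        by_contra hne
        exact absurd (hi _ (mem_insert_of_mem (hmem i hne))) (not_le.2 (hlow i m))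
      rcases v with j | x
      · have hj : j = i₀ := by
          by_contra hne; exact hvT (hmem j hne)
        subst hj
        exact absurd (hi _ (mem_insert_self _ _)) (not_le.2 (hlow _ m))
      · exact hu i₀ (le_antisymm (hm x (mem_univ _)) (hi _ (mem_insert_self _ _)))
    · rintro rfl
      refine ⟨by simp [T₀], fun y => ?_⟩
      have key : ∀ s ∈ insert (.inr m) T₀, u i₀ (.inr m) ≤ u i₀ s := by
        intro s hs
        rcases Finset.mem_insert.1 hs with rfl | hs
        · exact le_rfl
        · obtain ⟨j, hj, rfl⟩ := mem_image.1 hs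
          exact (hhigh i₀ j m (mem_erase.1 hj).1.symm).le
      rcases y with j | x
      · refine ⟨j, fun s hs => ?_⟩
        rcases s with l | x
        · by_cases hl : j = l
          · rw [hl]
          · exact ((hlow j m).trans (hhigh j l m hl)).le
        · exact (hlow j x).le
      · exact ⟨i₀, fun s hs => (hm x (mem_univ _)).trans (key s hs)⟩
  have hother : ∀ T ∈ D.erase T₀, Even #{x | x ∉ T ∧ IsDominant u (insert x T)} := by
    intro T hT
    obtain ⟨hTne, hTD⟩ := mem_erase.1 hT
    obtain ⟨hTk, hTl⟩ : #T + 1 = k ∧ T.image lab = univ.erase i₀ := by simpa [D] using hTD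
    by_cases hd : IsDominant u T
    -- A door made of slack elements alone is `T₀`, since slack elements carry their own labels.
    · obtain ⟨x, hx⟩ : ∃ x, (Sum.inr x : I ⊕ X) ∈ T := by
        by_contra hno
        push Not at hno
        apply hTne
        apply Finset.eq_of_subset_of_card_le
        · intro v hv
          rcases v with j | x
          · have : lab (.inl j) ∈ T.image lab := mem_image_of_mem _ hv
            rw [hTl] at this
            exact mem_image.2 ⟨j, this, rfl⟩
          · exact absurd hv (hno x)
        · rw [card_image_of_injective _ Sum.inl_injective, card_erase_of_mem (mem_univ _),
            Finset.card_univ]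
          omega
      rw [hd.card_completions hu ⟨_, hx⟩ hTk]
      · exact even_two
      · intro a j haj t ht hta htj
        refine ⟨.inl a, fun b hb => ⟨.inr x, hx, hhigh b a x hb⟩⟩
    · rw [Finset.filter_eq_empty_iff.2]
      · simp
      · rintro x - ⟨-, h⟩
        exact hd (h.mono (subset_insert _ _))
  rw [← hdouble, sum_congr rfl hcount, ← add_sum_erase _ _ hT₀D, hT₀] at hright
  have := Finset.even_sum _ hother
  rw [Nat.even_add] at hright
  exact absurd (hright.2 this) (by decide)

/-- Scarf's lemma without slack elements. -/
theorem exists_finset_forall_exists_label_le {I X : Type*} [Finite I] [Finite X] [Nonempty X]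
    (a : I → X → ℕ) (c : X → I) :
    ∃ σ : Finset X, ∀ y, ∃ i, (∃ x ∈ σ, c x = i) ∧ ∀ x ∈ σ, a i y ≤ a i x := by
  classical
  cases nonempty_fintype I
  cases nonempty_fintype X
  obtain ⟨B, hB⟩ : ∃ B, ∀ i x, a i x < B := by
    obtain ⟨B, hB⟩ := (Set.finite_range fun q : I × X => a q.1 q.2).bddAbove
    exact ⟨B + 1, fun i x => Nat.lt_succ_of_le (hB ⟨(i, x), rfl⟩)⟩
  let e := Fintype.equivFin (I ⊕ X)
  -- Each slack is worst for its own utility and above all points for the others; the second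
  -- lexicographic component in `u` breaks ties to obtain injectivity.
  let b : I → I ⊕ X → ℕ := fun i => Sum.elim (fun j => if i = j then 0 else B + 1)
    (fun x => a i x + 1)
  let u : I → I ⊕ X → ℕ ×ₗ Fin (Fintype.card (I ⊕ X)) := fun i v => toLex (b i v, e v)
  have hlt : ∀ i v w, b i v < b i w → u i v < u i w := fun i v w h =>
    Prod.Lex.toLex_lt_toLex.2 (Or.inl h)
  have hle : ∀ i v w, u i v ≤ u i w → b i v ≤ b i w := fun i v w h =>
    le_of_not_gt fun h' => absurd h (not_le.2 (hlt i w v h'))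
  obtain ⟨S, hS, hSl⟩ := exists_isDominant_image_eq_univ (u := u)
    (fun i v w h => e.injective (congrArg (fun q => (ofLex q).2) h))
    (fun i x => hlt _ _ _ (by simp [b]))
    (fun i j x hij => hlt _ _ _ (by simp [b, hij, hB])) c
  refine ⟨univ.filter fun x => .inr x ∈ S, fun y => ?_⟩
  obtain ⟨i, hi⟩ := hS (.inr y)
  refine ⟨i, ?_, fun x hx => ?_⟩
  · have : i ∈ S.image (Sum.elim id c) := by rw [hSl]; exact mem_univ i
    obtain ⟨v, hv, hvi⟩ := mem_image.1 this
    -- The slack of `i` cannot lie in `S`: its `b i`-value is `0`, yet `y`, of value at least `1`,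
    -- is no better than any element of `S`.
    rcases v with j | x
    · obtain rfl : j = i := hvi
      have := hle _ _ _ (hi _ hv)
      simp [b] at this
    · exact ⟨x, by simpa using hv, hvi⟩
  · have := hle _ _ _ (hi (.inr x) (by simpa using hx))
    simpa [b] using this

/-! ### From grids to the simplex and the variational inequality -/

/-- A discrete approximation, at scale `1 / M`, of `exists_stdSimplex_forall_pos_le`. -/
theorem exists_stdSimplex_approx {I : Type*} [Fintype I] [Nonempty I] (g : (I → ℝ) → I → ℝ)
    {M : ℕ} (hM : 0 < M) :
    ∃ x ∈ stdSimplex ℝ I, ∀ i, x i ≤ Fintype.card I / (M : ℝ) ∨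
      ∃ x' ∈ stdSimplex ℝ I, (∀ j, |x' j - x j| ≤ Fintype.card I / (M : ℝ)) ∧
        ∀ j, g x' j ≤ g x' i := by
  classical
  let X : Finset (I → ℕ) := Finset.piAntidiag univ M
  have hX : ∀ x : X, ∑ i, x.1 i = M := fun x => (Finset.mem_piAntidiag.1 x.2).1
  have hXmem : ∀ x : I → ℕ, ∑ i, x i = M → x ∈ X := fun x hx =>
    Finset.mem_piAntidiag.2 ⟨hx, fun i _ => mem_univ i⟩
  obtain ⟨i₁⟩ := ‹Nonempty I›
  have hXne : Nonempty X := ⟨⟨Pi.single i₁ M, hXmem _ (by simp)⟩⟩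
  let s : X → I → ℝ := fun x i => (x.1 i : ℝ) / M
  have hM' : (0 : ℝ) < M := by exact_mod_cast hM
  have hs : ∀ x, s x ∈ stdSimplex ℝ I := fun x => by
    refine ⟨fun i => by positivity, ?_⟩
    simp only [s]
    rw [← Finset.sum_div, ← Nat.cast_sum, hX x, div_self hM'.ne']
  have hc : ∀ x : X, ∃ i, ∀ j, g (s x) j ≤ g (s x) i := fun x => by
    obtain ⟨i, -, hi⟩ := Finset.exists_max_image univ (g (s x)) ⟨i₁, mem_univ _⟩
    exact ⟨i, fun j => hi j (mem_univ _)⟩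
  choose c hc using hc
  obtain ⟨σ, hσ⟩ := exists_finset_forall_exists_label_le (fun i (x : X) => x.1 i) c
  obtain ⟨x₀, hx₀⟩ : σ.Nonempty := by
    obtain ⟨y⟩ := hXne
    obtain ⟨i, ⟨x, hx, -⟩, -⟩ := hσ y
    exact ⟨x, hx⟩
  have hf : ∀ i, ∃ t ∈ σ, ∀ x ∈ σ, t.1 i ≤ x.1 i := fun i =>
    σ.exists_min_image (fun x => x.1 i) ⟨x₀, hx₀⟩
  choose f hfσ hfmin using hf
  let m : I → ℕ := fun i => if i ∈ σ.image c then (f i).1 i else 0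
  have hmle : ∀ x ∈ σ, ∀ i, m i ≤ x.1 i := by
    intro x hx i
    simp only [m]
    split_ifs
    · exact hfmin i x hx
    · exact Nat.zero_le _
  -- If the minima `m` left a deficit of at least `Fintype.card I`, some grid point would exceed `m`
  -- in every coordinate, against the choice of `σ`. Hence all points of `σ` are within
  -- `Fintype.card I` of `m`, and so of each other.
  have hmsum : M < ∑ i, m i + Fintype.card I := by
    by_contra hle
    rw [not_lt] at hle
    have hsum : ∑ i, (m i + 1) ≤ M := by
      rw [sum_add_distrib]; simpa using hle
    let y : I → ℕ := fun i => (m i + 1) + if i = i₁ then M - ∑ i, (m i + 1) else 0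
    have hy : ∑ i, y i = M := by
      simp only [y]
      rw [sum_add_distrib, sum_ite_eq' univ i₁, if_pos (mem_univ _)]
      omega
    obtain ⟨i, ⟨x, hx, hxi⟩, hi⟩ := hσ ⟨y, hXmem y hy⟩
    have h1 := hi (f i) (hfσ i)
    have h2 : m i = (f i).1 i := if_pos (mem_image.2 ⟨x, hx, hxi⟩)
    simp only [y] at h1
    omega
  have hlt : ∀ x ∈ σ, ∀ i, x.1 i < m i + Fintype.card I := by
    intro x hx i
    have h1 := hX x
    rw [← add_sum_erase _ _ (mem_univ i)] at h1 hmsum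
    have h2 : ∑ j ∈ univ.erase i, m j ≤ ∑ j ∈ univ.erase i, x.1 j :=
      sum_le_sum fun j _ => hmle x hx j
    omega
  refine ⟨s x₀, hs x₀, fun i => ?_⟩
  by_cases hi : i ∈ σ.image c
  · obtain ⟨x, hx, rfl⟩ := mem_image.1 hi
    refine Or.inr ⟨s x, hs x, fun j => ?_, hc x⟩
    have h1 := hlt x hx j
    have h2 := hlt x₀ hx₀ j
    have h3 := hmle x hx j
    have h4 := hmle x₀ hx₀ j
    simp only [s]
    rw [← sub_div, abs_div, abs_of_pos hM']
    refine div_le_div_of_nonneg_right ?_ hM'.le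
    rw [abs_le]
    constructor
    · have : (x₀.1 j : ℝ) ≤ x.1 j + Fintype.card I := by norm_cast; omega
      linarith
    · have : (x.1 j : ℝ) ≤ x₀.1 j + Fintype.card I := by norm_cast; omega
      linarith
  · left
    have h1 := hlt x₀ hx₀ i
    have h2 : m i = 0 := if_neg hi
    refine div_le_div_of_nonneg_right ?_ hM'.le
    norm_cast
    omega

/-- A continuous payoff `g` on a simplex has a point whose support consists of coordinates at which
the payoff is maximal. -/
theorem exists_stdSimplex_forall_pos_le {I : Type*} [Fintype I] [Nonempty I]
    {g : (I → ℝ) → I → ℝ} (hg : ContinuousOn g (stdSimplex ℝ I)) :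
    ∃ x ∈ stdSimplex ℝ I, ∀ i, 0 < x i → ∀ j, g x j ≤ g x i := by
  choose x hx hxi using fun n : ℕ => exists_stdSimplex_approx g (Nat.succ_pos n)
  obtain ⟨z, hz, φ, hφ, hlim⟩ := (isCompact_stdSimplex ℝ I).tendsto_subseq hx
  refine ⟨z, hz, fun i hi j => ?_⟩
  have hδ : Tendsto (fun n => (Fintype.card I : ℝ) / ((φ n).succ : ℝ)) atTop (𝓝 0) := by
    have := (tendsto_const_div_atTop_nhds_zero_nat (Fintype.card I : ℝ)).comp
      ((tendsto_add_atTop_nat 1).comp hφ.tendsto_atTop)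
    exact this
  have hev : ∀ᶠ n in atTop, (Fintype.card I : ℝ) / ((φ n).succ : ℝ) < x (φ n) i :=
    hδ.eventually_lt (((continuous_apply i).tendsto z).comp hlim) hi
  -- The implication gives a companion point for every `n`, arbitrary while coordinate `i` is small;
  -- since `z i > 0`, the premise eventually holds.
  have hex : ∀ n, ∃ x' ∈ stdSimplex ℝ I,
      (Fintype.card I : ℝ) / ((φ n).succ : ℝ) < x (φ n) i →
        (∀ j, |x' j - x (φ n) j| ≤ Fintype.card I / ((φ n).succ : ℝ)) ∧
          ∀ j, g x' j ≤ g x' i := by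
    intro n
    rcases hxi (φ n) i with h | ⟨x', hx', h⟩
    · exact ⟨x (φ n), hx _, fun h' => absurd h (not_le.2 h')⟩
    · exact ⟨x', hx', fun _ => h⟩
  choose w hw hwn using hex
  have hwlim : Tendsto w atTop (𝓝 z) := by
    rw [tendsto_pi_nhds]
    intro l
    have h0 : Tendsto (fun n => w n l - x (φ n) l) atTop (𝓝 0) := by
      refine squeeze_zero_norm' ?_ hδ
      filter_upwards [hev] with n hn
      exact (hwn n hn).1 l
    have := h0.add (((continuous_apply l).tendsto z).comp hlim)
    simpa using this
  have hgw : Tendsto (fun n => g (w n)) atTop (𝓝 (g z)) :=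
    (hg z hz).tendsto.comp (tendsto_nhdsWithin_iff.2 ⟨hwlim, Eventually.of_forall hw⟩)
  refine le_of_tendsto_of_tendsto (tendsto_pi_nhds.1 hgw j) (tendsto_pi_nhds.1 hgw i) ?_
  filter_upwards [hev] with n hn
  exact (hwn n hn).2 j

/-- The Hartman–Stampacchia theorem: a continuous vector field on a compact convex set solves a
variational inequality. -/
theorem exists_forall_inner_le {V : Type*} [NormedAddCommGroup V] [InnerProductSpace ℝ V]
    {P : Set V} (hP : IsCompact P) (hconv : Convex ℝ P) (hne : P.Nonempty) {Z : V → V}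
    (hZ : ContinuousOn Z P) :
    ∃ p ∈ P, ∀ q ∈ P, inner ℝ q (Z p) ≤ inner ℝ p (Z p) := by
  let K : P → Set V := fun q => {p | p ∈ P ∧ inner ℝ (q : V) (Z p) ≤ inner ℝ p (Z p)}
  have hK : ∀ q, IsClosed (K q) := fun q => by
    refine hP.isClosed.isClosed_le (continuousOn_const.inner hZ) (continuousOn_id.inner hZ)
  obtain ⟨p, hp, hpK⟩ : (P ∩ ⋂ q, K q).Nonempty := by
    refine hP.inter_iInter_nonempty K hK fun u => ?_
    rcases u.eq_empty_or_nonempty with rfl | hu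
    · simpa using hne
    have : Nonempty u := hu.to_subtype
    -- In barycentric coordinates over `u`, take `⟪q, Z (b x)⟫` as the payoff of `q`. If `x` charges
    -- only maximal payoffs, their average `⟪b x, Z (b x)⟫` dominates each of them.
    let b : (u → ℝ) → V := fun x => ∑ i, x i • (i.1 : V)
    have hb : ∀ x ∈ stdSimplex ℝ u, b x ∈ P := fun x hx =>
      hconv.sum_mem (fun i _ => hx.1 i) hx.2 fun i _ => i.1.2
    have hbc : Continuous b := by fun_prop
    obtain ⟨x, hx, hmax⟩ := exists_stdSimplex_forall_pos_le
      (g := fun x (i : u) => inner ℝ (i.1 : V) (Z (b x))) (by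
        refine continuousOn_pi.2 fun i => continuousOn_const.inner ?_
        exact hZ.comp hbc.continuousOn hb)
    refine ⟨b x, hb x hx, Set.mem_iInter₂.2 fun q hq => ⟨hb x hx, ?_⟩⟩
    calc inner ℝ (q : V) (Z (b x)) = ∑ i, x i * inner ℝ (q : V) (Z (b x)) := by
          rw [← Finset.sum_mul, hx.2, one_mul]
      _ ≤ ∑ i, x i * inner ℝ (i.1 : V) (Z (b x)) := by
          refine sum_le_sum fun i _ => ?_
          rcases (hx.1 i).eq_or_lt with h | h
          · rw [← h]; simp
          · exact mul_le_mul_of_nonneg_left (hmax i h ⟨q, hq⟩) h.le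
      _ = inner ℝ (b x) (Z (b x)) := by
          simp only [b, sum_inner, real_inner_smul_left]
  exact ⟨p, hp, fun q hq => (Set.mem_iInter.1 hpK ⟨q, hq⟩).2⟩

/-! ### Preferences, demand and Walras' law -/

theorem IsPreference.trans {X : Type} {r : X → X → Prop} (hr : IsPreference r) {x y z : X}
    (hxy : r x y) (hyz : r y z) : r x z :=
  (hr.negTrans x y hxy z).resolve_right fun h => hr.asymm _ _ h hyz

/-- Without a maximal element, the open sets of points worse than a given affordable `x` cover the
compact budget set. Among the finitely many `x` of a subcover one is maximal, and it is left
uncovered. -/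
theorem demandSet_nonempty {N : ℕ} {X : Set (Commodity N)} {r : X → X → Prop}
    (hX : IsCompact X) (hr : IsPreference r) (hc : IsContinuousPref r) {p : Commodity N} {w : ℝ}
    (hne : (budgetSet X p w).Nonempty) : (demandSet r p w).Nonempty := by
  have : CompactSpace X := isCompact_iff_compactSpace.1 hX
  have hB : IsCompact (budgetSet X p w) := by
    refine (isClosed_le ?_ continuous_const).isCompact
    fun_prop
  by_contra hcon
  have hcover : budgetSet X p w ⊆ ⋃ x ∈ budgetSet X p w, {ξ | r x ξ} := by
    intro ξ hξ
    by_contra h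
    simp only [Set.mem_iUnion, Set.mem_ofPred_eq, not_exists] at h
    exact hcon ⟨ξ, hξ, h⟩
  obtain ⟨b, hbB, hbf, hb⟩ := hB.elim_finite_subcover_image
    (fun x _ => hc.preimage (Continuous.prodMk_right x)) hcover
  obtain ⟨ξ₀, hξ₀⟩ := hne
  have hbne : b.Nonempty := by
    obtain ⟨x, hx, -⟩ := Set.mem_iUnion₂.1 (hb hξ₀)
    exact ⟨x, hx⟩
  have : Finite b := hbf
  let r' : b → b → Prop := fun x y => r x y
  have : IsTrans b r' := ⟨fun _ _ _ => hr.trans⟩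
  have : Std.Irrefl r' := ⟨fun x h => hr.asymm _ _ h h⟩
  obtain ⟨y, -, hy⟩ := (Finite.wellFounded_of_trans_of_irrefl r').has_min Set.univ
    ⟨⟨_, hbne.some_mem⟩, Set.mem_univ _⟩
  obtain ⟨x, hx, hxy⟩ := Set.mem_iUnion₂.1 (hb (hbB y.2))
  exact hy ⟨x, hx⟩ (Set.mem_univ _) hxy

theorem demandSet_subsingleton {N : ℕ} {X : Set (Commodity N)} {r : X → X → Prop}
    (hs : IsStrictlyConvexPref r) (p : Commodity N) (w : ℝ) : (demandSet r p w).Subsingleton := by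
  intro x hx y hy
  by_contra hne
  have hz : (1 / 2 : ℝ) • (x : Commodity N) + (1 - 1 / 2 : ℝ) • (y : Commodity N) ∈ X :=
    hs.1 x.2 y.2 (by norm_num) (by norm_num) (by norm_num)
  have hzB : (⟨_, hz⟩ : X) ∈ budgetSet X p w := by
    have h1 : inner ℝ p (x : Commodity N) ≤ w := hx.1
    have h2 : inner ℝ p (y : Commodity N) ≤ w := hy.1
    simp only [budgetSet, Set.mem_ofPred_eq, inner_add_right, inner_smul_right]
    linarith
  rcases hs.2 x y hne (1 / 2) (by norm_num) (by norm_num) ⟨_, hz⟩ rfl with h | h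
  · exact hx.2 _ hzB h
  · exact hy.2 _ hzB h

/-- The graph of the demand correspondence is closed over the prices at which some point of the
consumption set costs less than the budget. -/
theorem isClosed_demandSet_graph {N : ℕ} {X : Set (Commodity N)} {r : X → X → Prop}
    (hX : Convex ℝ X) (hc : IsContinuousPref r) {P : Set (Commodity N)} {w : ℝ}
    (hcheap : ∀ p ∈ P, ∃ x ∈ X, inner ℝ p x < w) :
    IsClosed {q : P × X | q.2 ∈ demandSet r (q.1 : Commodity N) w} := by
  -- It suffices to test against `x` strictly inside the budget, which is an open condition on `p`:
  -- a preferred `x` on the budget line can be moved slightly towards the cheap point `v` and stays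
  -- preferred.
  have heq : {q : P × X | q.2 ∈ demandSet r (q.1 : Commodity N) w} =
      {q : P × X | inner ℝ (q.1 : Commodity N) (q.2 : Commodity N) ≤ w} ∩
        ⋂ x : X, ({q : P × X | inner ℝ (q.1 : Commodity N) (x : Commodity N) < w} ∩
          {q : P × X | r x q.2})ᶜ := by
    ext ⟨⟨p, hp⟩, ξ⟩
    simp only [Set.mem_ofPred_eq, Set.mem_inter_iff, Set.mem_iInter, Set.mem_compl_iff, not_and,
      demandSet, budgetSet]
    refine and_congr_right fun _ => ⟨fun h x hx => h x hx.le, fun h x hx hxξ => ?_⟩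
    obtain ⟨v, hv, hvw⟩ := hcheap p hp
    let f : unitInterval → X := fun t => ⟨(1 - (t : ℝ)) • (x : Commodity N) + (t : ℝ) • v,
      hX x.2 hv (by linarith [t.2.2]) t.2.1 (by ring)⟩
    have hf : Continuous f := by
      refine Continuous.subtype_mk ?_ _
      fun_prop
    have hf0 : f 0 = x := by ext1; simp [f]
    have hopen : IsOpen {t | r (f t) ξ} := hc.preimage (hf.prodMk continuous_const)
    have h0 : ∀ᶠ t in 𝓝 (0 : unitInterval), r (f t) ξ :=
      hopen.mem_nhds (by simpa [hf0] using hxξ)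
    have hpos : ∃ᶠ t in 𝓝 (0 : unitInterval), 0 < t := by
      have : (𝓝[>] (0 : unitInterval)).NeBot := nhdsGT_neBot_of_exists_gt ⟨1, zero_lt_one⟩
      exact (frequently_nhdsWithin_iff.1
        (eventually_mem_nhdsWithin (a := (0 : unitInterval)) (s := Set.Ioi 0)).frequently).mono
          fun t ht => ht.2
    obtain ⟨t, ht, hrt⟩ := (hpos.and_eventually h0).exists
    have ht' : (0 : ℝ) < t := ht
    refine h (f t) ?_ hrt
    simp only [f, inner_add_right, inner_smul_right]
    nlinarith [t.2.2]
  rw [heq]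
  refine (isClosed_le (by fun_prop) continuous_const).inter (isClosed_iInter fun x => ?_)
  rw [isClosed_compl_iff]
  refine (isOpen_lt (by fun_prop) continuous_const).inter ?_
  exact hc.preimage (continuous_const.prodMk continuous_snd)

/-- A function into a compact space with closed graph is continuous. -/
theorem continuous_of_isClosed_graph {A B : Type*} [TopologicalSpace A] [TopologicalSpace B]
    [CompactSpace B] {f : A → B} (hf : IsClosed {q : A × B | q.2 = f q.1}) : Continuous f := by
  refine continuous_iff_isClosed.2 fun C hC => ?_
  -- The preimage of `C` is the projection of the part of the graph over `C`, and projection along a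
  -- compact factor is closed.
  have h := isClosedMap_fst_of_compactSpace (X := A) (Y := B) _
    (hf.inter (hC.preimage continuous_snd))
  convert h using 1
  ext a
  simp

/-- Walras' law: a demand that is not satiated exhausts the budget. -/
theorem inner_eq_of_mem_demandSet {N : ℕ} {X : Set (Commodity N)} {r : X → X → Prop}
    (hr : IsPreference r) (hs : IsStrictlyConvexPref r) {p : Commodity N} {w : ℝ} {ξ : X}
    (hξ : ξ ∈ demandSet r p w) {x : X} (hx : r x ξ) : inner ℝ p (ξ : Commodity N) = w := by
  have hle : inner ℝ p (ξ : Commodity N) ≤ w := hξ.1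
  refine hle.antisymm (le_of_not_gt fun hlt => ?_)
  have hxw : w < inner ℝ p (x : Commodity N) := lt_of_not_ge fun h => hξ.2 x h hx
  set α := inner ℝ p (ξ : Commodity N)
  set β := inner ℝ p (x : Commodity N)
  have hpos : 0 < β - α := by linarith
  -- This weight places the point of the segment from `ξ` to `x` exactly on the budget line.
  have ht0 : 0 < (w - α) / (β - α) := div_pos (by linarith) hpos
  have ht1 : (w - α) / (β - α) < 1 := (div_lt_one hpos).2 (by linarith)
  have ht : (w - α) / (β - α) * (β - α) = w - α := div_mul_cancel₀ _ hpos.ne'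
  set t := (w - α) / (β - α)
  have hz : t • (x : Commodity N) + (1 - t) • (ξ : Commodity N) ∈ X :=
    hs.1 x.2 ξ.2 ht0.le (by linarith) (by ring)
  have hzB : (⟨_, hz⟩ : X) ∈ budgetSet X p w := by
    simp only [budgetSet, Set.mem_ofPred_eq, inner_add_right, inner_smul_right]
    change t * β + (1 - t) * α ≤ w
    linarith
  have hne : x ≠ ξ := fun h => hr.asymm _ _ hx (h ▸ hx)
  rcases hs.2 x ξ hne t ht0 ht1 ⟨_, hz⟩ rfl with h | h
  · exact hξ.2 _ hzB (hr.trans h hx)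
  · exact hξ.2 _ hzB h

/-! ### Polar cones and their compact sections -/

/-- A point outside a closed convex cone is separated from it by an element of the polar cone. -/
theorem exists_polar_inner_pos {N : ℕ} {Y : Set (Commodity N)} (hclosed : IsClosed Y)
    (hconv : Convex ℝ Y) (hcone : IsConeSet Y) (h0 : 0 ∈ Y) {z : Commodity N} (hz : z ∉ Y) :
    ∃ q : Commodity N, (∀ y ∈ Y, inner ℝ q y ≤ 0) ∧ 0 < inner ℝ q z := by
  obtain ⟨f, s, hfs, hsz⟩ := geometric_hahn_banach_closed_point hconv hclosed hz
  have hs : 0 < s := by simpa using hfs 0 h0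
  refine ⟨(InnerProductSpace.toDual ℝ _).symm f, fun y hy => ?_, ?_⟩
  · rw [InnerProductSpace.toDual_symm_apply]
    -- A positive value of `f` at `y` could be scaled along the cone to equal `s`, against the
    -- strict bound.
    by_contra hpos
    rw [not_le] at hpos
    have := hfs _ (hcone (s / f y) (div_pos hs hpos) y hy)
    rw [map_smul, smul_eq_mul, div_mul_cancel₀ _ hpos.ne'] at this
    exact lt_irrefl _ this
  · rw [InnerProductSpace.toDual_symm_apply]
    exact hs.trans hsz

/-- If the `p`-value is nonpositive on `Y` and a closed ball around `y` lies in `Y`, then the value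
at `y` is negative in proportion to the norm of `p`. -/
theorem norm_mul_le_neg_inner {N : ℕ} {Y : Set (Commodity N)} {y p : Commodity N} {ρ : ℝ}
    (hρ : 0 ≤ ρ) (hy : Metric.closedBall y ρ ⊆ Y) (hp : ∀ y ∈ Y, inner ℝ p y ≤ 0) :
    ρ * ‖p‖ ≤ -inner ℝ p y := by
  rcases eq_or_ne p 0 with rfl | hne
  · simp
  have hn : 0 < ‖p‖ := norm_pos_iff.2 hne
  have := hp (y + (ρ / ‖p‖) • p) (hy (by
    rw [Metric.mem_closedBall, dist_eq_norm, add_sub_cancel_left, norm_smul, Real.norm_eq_abs,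
      abs_of_nonneg (by positivity), div_mul_cancel₀ _ hn.ne']))
  rw [inner_add_right, inner_smul_right, real_inner_self_eq_norm_sq] at this
  have h : ρ / ‖p‖ * ‖p‖ ^ 2 = ρ * ‖p‖ := by field_simp
  linarith

/-- Supplies the points of negative cost needed for the continuity of demand, and the normalization
of polar prices. -/
theorem inner_neg_of_mem_interior {N : ℕ} {Y : Set (Commodity N)} {y p : Commodity N}
    (hy : y ∈ interior Y) (hp : ∀ y ∈ Y, inner ℝ p y ≤ 0) (hne : p ≠ 0) : inner ℝ p y < 0 := by
  obtain ⟨ρ, hρ, hball⟩ := Metric.nhds_basis_closedBall.mem_iff.1 (mem_interior_iff_mem_nhds.1 hy)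
  have := norm_mul_le_neg_inner hρ.le hball hp
  have : 0 < ρ * ‖p‖ := mul_pos hρ (norm_pos_iff.2 hne)
  linarith

/-- The section of the polar cone of `Y` by an interior point of `Y` is compact. -/
theorem isCompact_polar_section {N : ℕ} {Y : Set (Commodity N)} {y : Commodity N}
    (hy : y ∈ interior Y) :
    IsCompact {p : Commodity N | (∀ z ∈ Y, inner ℝ p z ≤ 0) ∧ inner ℝ p y = -1} := by
  obtain ⟨ρ, hρ, hball⟩ := Metric.nhds_basis_closedBall.mem_iff.1 (mem_interior_iff_mem_nhds.1 hy)
  refine Metric.isCompact_of_isClosed_isBounded ?_ ?_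
  · have : {p : Commodity N | (∀ z ∈ Y, inner ℝ p z ≤ 0) ∧ inner ℝ p y = -1} =
        (⋂ z ∈ Y, {p : Commodity N | inner ℝ p z ≤ 0}) ∩ {p | inner ℝ p y = -1} := by
      ext p; simp
    rw [this]
    exact (isClosed_biInter fun z _ => isClosed_le (by fun_prop) continuous_const).inter
      (isClosed_eq (by fun_prop) continuous_const)
  · refine (Metric.isBounded_closedBall (x := 0) (r := 1 / ρ)).subset fun p hp => ?_
    have := norm_mul_le_neg_inner hρ.le hball hp.1
    rw [hp.2, neg_neg] at this
    rw [mem_closedBall_zero_iff, le_div_iff₀ hρ]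
    linarith

theorem convex_polar_section {N : ℕ} (Y : Set (Commodity N)) (y : Commodity N) :
    Convex ℝ {p : Commodity N | (∀ z ∈ Y, inner ℝ p z ≤ 0) ∧ inner ℝ p y = -1} := by
  intro p hp q hq a b ha hb hab
  refine ⟨fun z hz => ?_, ?_⟩
  · rw [inner_add_left, real_inner_smul_left, real_inner_smul_left]
    have h1 := mul_nonpos_of_nonneg_of_nonpos ha (hp.1 z hz)
    have h2 := mul_nonpos_of_nonneg_of_nonpos hb (hq.1 z hz)
    linarith
  · rw [inner_add_left, real_inner_smul_left, real_inner_smul_left, hp.2, hq.2]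
    linarith

/-! ### Continuous demand and existence of equilibrium -/

/-- The demands of a single consumer depend continuously on the prices. -/
theorem exists_continuous_demand {N : ℕ} {X : Set (Commodity N)} {r : X → X → Prop}
    (hX : IsCompact X) (hr : IsPreference r) (hc : IsContinuousPref r)
    (hs : IsStrictlyConvexPref r) {P : Set (Commodity N)} {w : ℝ}
    (hcheap : ∀ p ∈ P, ∃ x ∈ X, inner ℝ p x < w) :
    ∃ F : P → X, Continuous F ∧ ∀ p : P, F p ∈ demandSet r (p : Commodity N) w := by
  have : CompactSpace X := isCompact_iff_compactSpace.1 hX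
  have hne : ∀ p : P, (demandSet r (p : Commodity N) w).Nonempty := fun p => by
    obtain ⟨x, hx, hxw⟩ := hcheap p p.2
    exact demandSet_nonempty hX hr hc ⟨⟨x, hx⟩, hxw.le⟩
  choose F hF using hne
  refine ⟨F, continuous_of_isClosed_graph ?_, hF⟩
  convert isClosed_demandSet_graph hs.1 hc hcheap using 1
  ext ⟨p, ξ⟩
  exact ⟨fun h => by rw [Set.mem_ofPred_eq, show ξ = F p from h]; exact hF p,
    fun h => demandSet_subsingleton hs _ _ h (hF p)⟩

/-- An economy satisfying the hypotheses of the existence theorem has demands whose sum lies in the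
aggregate production set. -/
theorem Economy.exists_demand_sum_mem_aggregate {N n m : ℕ} (E : Economy N n m)
    (hcompact : ∀ i, IsCompact (E.consumption i))
    (hcont : ∀ i, IsContinuousPref (E.pref i))
    (hstrict : ∀ i, IsStrictlyConvexPref (E.pref i))
    (hint : ∀ i, (interior (E.consumption i ∩ E.aggregate)).Nonempty)
    (hclosed : IsClosed E.aggregate) (hconv : Convex ℝ E.aggregate)
    (hcone : IsConeSet E.aggregate)
    (horthant : E.aggregate ∩ {x : Commodity N | ∀ j, 0 ≤ x j} = {0}) :
    ∃ (p : Commodity N) (ξ : ∀ i, E.consumption i),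
      (∀ i, ξ i ∈ E.demand i p) ∧ ∑ i, (ξ i : Commodity N) ∈ E.aggregate := by
  set Y := E.aggregate
  have h0 : (0 : Commodity N) ∈ Y := by
    have : (0 : Commodity N) ∈ Y ∩ {x : Commodity N | ∀ j, 0 ≤ x j} := by rw [horthant]; rfl
    exact this.1
  rcases isEmpty_or_nonempty (Fin m) with hm | ⟨⟨i₀⟩⟩
  · exact ⟨0, fun i => hm.elim i, fun i => hm.elim i, by simpa using h0⟩
  -- In dimension zero no price has value `-1` at a point, so the section `P` below would be empty;
  -- there the only bundle is `0`.
  rcases isEmpty_or_nonempty (Fin N) with hN | ⟨⟨j₀⟩⟩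
  · have hsub : ∀ x : Commodity N, x = 0 := fun x => by ext j; exact hN.elim j
    refine ⟨0, fun i => ⟨_, (interior_subset (hint i).some_mem).1⟩, fun i => ⟨?_, ?_⟩, ?_⟩
    · simp [budgetSet]
    · intro x _ hx
      have := (E.isPreference i).asymm _ _ hx
      rw [Subtype.ext ((hsub x).trans (hsub _).symm)] at hx this
      exact this hx
    · rw [hsub (∑ i, _)]; exact h0
  choose v hv using hint
  have hvX : ∀ i, v i ∈ E.consumption i := fun i => (interior_subset (hv i)).1
  have hvY : ∀ i, v i ∈ interior Y := fun i => interior_mono Set.inter_subset_right (hv i)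
  set P : Set (Commodity N) := {p | (∀ z ∈ Y, inner ℝ p z ≤ 0) ∧ inner ℝ p (v i₀) = -1}
  have hnormalize : ∀ q : Commodity N, (∀ y ∈ Y, inner ℝ q y ≤ 0) → q ≠ 0 →
      ∃ t : ℝ, 0 < t ∧ t • q ∈ P := by
    intro q hq hq0
    have hneg := inner_neg_of_mem_interior (hvY i₀) hq hq0
    refine ⟨(-inner ℝ q (v i₀))⁻¹, inv_pos.2 (by linarith), fun z hz => ?_, ?_⟩
    · rw [real_inner_smul_left]
      exact mul_nonpos_of_nonneg_of_nonpos (inv_nonneg.2 (by linarith)) (hq z hz)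
    · rw [real_inner_smul_left, inv_neg, neg_mul, inv_mul_cancel₀ hneg.ne]
  have hPne : P.Nonempty := by
    -- A unit vector lies outside `Y` by the orthant condition, so separating it yields a nonzero
    -- polar price.
    have he : EuclideanSpace.single j₀ (1 : ℝ) ∉ Y := by
      intro h
      have h1 : EuclideanSpace.single j₀ (1 : ℝ) ∈ Y ∩ {x : Commodity N | ∀ j, 0 ≤ x j} := by
        refine ⟨h, fun j => ?_⟩
        rw [PiLp.single_apply]
        split_ifs <;> norm_num
      rw [horthant, Set.mem_singleton_iff] at h1
      simpa using congrArg (fun x : Commodity N => x j₀) h1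
    obtain ⟨q, hq, hqpos⟩ := exists_polar_inner_pos hclosed hconv hcone h0 he
    obtain ⟨t, -, ht⟩ := hnormalize q hq (by rintro rfl; simp at hqpos)
    exact ⟨_, ht⟩
  have hcheap : ∀ i, ∀ p ∈ P, ∃ x ∈ E.consumption i, inner ℝ p x < 0 := fun i p hp =>
    ⟨v i, hvX i, inner_neg_of_mem_interior (hvY i) hp.1 (by
      rintro rfl; have := hp.2; simp at this)⟩
  choose F hFc hF using fun i => exists_continuous_demand (hcompact i) (E.isPreference i)
    (hcont i) (hstrict i) (hcheap i)
  classical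
  let Z : Commodity N → Commodity N := fun p =>
    if hp : p ∈ P then ∑ i, (F i ⟨p, hp⟩ : Commodity N) else 0
  have hZP : ∀ p : P, Z p = ∑ i, (F i p : Commodity N) := fun p => dif_pos p.2
  have hZ : ContinuousOn Z P := by
    rw [continuousOn_iff_continuous_domRestrict]
    have : P.domRestrict Z = fun p => ∑ i, (F i p : Commodity N) := funext hZP
    rw [this]
    fun_prop
  obtain ⟨p, hp, hpq⟩ := exists_forall_inner_le (isCompact_polar_section (hvY i₀))
    (convex_polar_section Y (v i₀)) hPne hZ
  refine ⟨p, fun i => F i ⟨p, hp⟩, fun i => hF i ⟨p, hp⟩, ?_⟩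
  rw [← hZP ⟨p, hp⟩]
  by_contra hnot
  obtain ⟨q, hq, hqpos⟩ := exists_polar_inner_pos hclosed hconv hcone h0 hnot
  obtain ⟨t, ht, htP⟩ := hnormalize q hq (by rintro rfl; simp at hqpos)
  have h1 := hpq _ htP
  have h2 : inner ℝ p (Z p) ≤ 0 := by
    rw [hZP ⟨p, hp⟩, inner_sum]
    exact Finset.sum_nonpos fun i _ => (hF i ⟨p, hp⟩).1
  rw [real_inner_smul_left] at h1
  have h3 := mul_pos ht hqpos
  linarith

end

theorem mainTheorem5 (hFT : FanTheorem) {N n m : ℕ} (E : Economy N n m)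
    (h_compact_convex : ∀ i, IsCompact (E.consumption i) ∧ Convex ℝ (E.consumption i))
    (h_pref : ∀ i, IsContinuousPref (E.pref i) ∧ IsStrictlyConvexPref (E.pref i))
    (h_interior : ∀ i, (interior (E.consumption i ∩ E.aggregate)).Nonempty)
    (h_cone : IsLocated E.aggregate ∧ IsClosed E.aggregate ∧ Convex ℝ E.aggregate ∧
      IsConeSet E.aggregate)
    (h_orthant : E.aggregate ∩ {x : Commodity N | ∀ j, 0 ≤ x j} = {0})
    (h_nonsatiation : ∀ (p : Commodity N) (F : ∀ i : Fin m, E.consumption i),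
      (∀ i, F i ∈ E.demand i p) → ∑ i, (F i : Commodity N) ∈ E.aggregate →
        ∀ i, ∃ x : E.consumption i, E.pref i x (F i)) :
    E.HasApproxEquilibria := by
  intro ε hε
  obtain ⟨-, hclosed, hconv, hcone⟩ := h_cone
  obtain ⟨p, ξ, hξ, hsum⟩ := E.exists_demand_sum_mem_aggregate
    (fun i => (h_compact_convex i).1) (fun i => (h_pref i).1) (fun i => (h_pref i).2)
    h_interior hclosed hconv hcone h_orthant
  refine ⟨p, ξ, _, hsum, hξ, rfl, ?_⟩
  -- Nonsatiation is available because total demand lies in `Y`; by Walras' law every consumer then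
  -- spends exactly `0`.
  have hzero : ∀ i, inner ℝ p (ξ i : Commodity N) = 0 := fun i =>
    (h_nonsatiation p ξ hξ hsum i).elim fun _ hx =>
      inner_eq_of_mem_demandSet (E.isPreference i) (h_pref i).2 (hξ i) hx
  rw [inner_sum, Finset.sum_eq_zero fun i _ => hzero i]
  linarith
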